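/- Work in continuous logic with a one-sorted, $1$-bounded metric signature $L$. That is, $L$ has predicate symbols, function symbols and constant symbols, and each predicate or function symbol $s$ has an arity and a modulus of uniform continuity $\Delta_s\colon(0,1]\to(0,1]$. An $L$-structure $M$ is a nonempty complete metric space $(M,d)$ with $d\le 1$, together with interpretations $P^M\colon M^n\to[0,1]$ and $F^M\colon M^n\to M$ of the symbols such that, for every symbol $s$, every $\epsilon\in(0,1]$ and all tuples $a,b$, if $d(a,b)<\Delta_s(\epsilon)$ then $s^M(a)$ and $s^M(b)$ are at distance at most $\epsilon$ (tuples carry the maximum metric). An almost $L$-structure is defined in the same way, except that for each symbol $s$ this condition is only required for all sufficiently small $\epsilon$. $L$-formulas are built from the atomic formulas $d(t_1,t_2)$ and $P(t_1,\dots,t_n)$, with $t_i$ terms, using all continuous functions $[0,1]^n\to[0,1]$ as connectives and $\sup_x$, $\inf_x$ as quantifiers; sentences are formulas without free variables. An $L$-structure $M$ is - strongly pseudofinite (respectively almost strongly pseudofinite) if for every $L$-sentence $\sigma$ with $\sigma^M=0$ there is a finite $L$-structure (respectively a finite almost $L$-structure) $A$ with $\sigma^A=0$; - $\omega$-saturated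 if, for every finite $A\subseteq M$ and every set $\Gamma(x_1,\dots,x_n)$ of conditions $\varphi(x_1,\dots,x_n)=0$ with $\varphi$ an $L$-formula with parameters from $A$, if every finite subset of $\Gamma$ is satisfied by a tuple from $M$, then $\Gamma$ is satisfied by a tuple from $M$. A function $f\colon M\to M$ is formula-definable if there are an $L$-formula $\varphi(x,y,z)$, where $z$ is a finite tuple of variables, and a tuple $a$ from $M$ such that $d(f(x),y)=\varphi^M(x,y,a)$ for all $x,y\in M$. **Proposition.** Let $M$ be an $\omega$-saturated $L$-structure and let $f\colon M\to M$ be formula-definable and surjective. If $M$ is strongly pseudofinite, then $f$ is injective. The same conclusion holds if $M$ is only almost strongly pseudofinite. -/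

import Mathlib

universe u v w

noncomputable section

namespace ContLogic

/-- A modulus of uniform continuity: an arbitrary function `(0,1] → (0,1]`. -/
abbrev Modulus : Type := Set.Ioc (0 : ℝ) 1 → Set.Ioc (0 : ℝ) 1

/-- A one-sorted, 1-bounded metric signature: function symbols and predicate symbols with their
arities (constant symbols are the function symbols of arity `0`), and a modulus of uniform
continuity for each symbol. Predicates take values in `[0,1]`, and `d ≤ 1`. -/
structure MetricSignature where
  lang : FirstOrder.Language.{u, v}
  funModulus : ∀ {n : ℕ}, lang.Functions n → Modulus
  predModulus : ∀ {n : ℕ}, lang.Relations n → Modulus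

/-- `L`-formulas with free variables indexed by `Fin n`. Atomic formulas are `d(t₁,t₂)` and
`P(t₁,…,tₖ)`; every continuous function `[0,1]^k → [0,1]` is a connective; the quantifiers are
`sup` and `inf`, and they bind the last variable. -/
inductive Formula (L : MetricSignature.{u, v}) : ℕ → Type (max u v)
  | dist {n : ℕ} (t₁ t₂ : L.lang.Term (Fin n)) : Formula L n
  | pred {n k : ℕ} (P : L.lang.Relations k) (ts : Fin k → L.lang.Term (Fin n)) : Formula L n
  | conn {n k : ℕ} (c : C(Fin k → unitInterval, unitInterval)) (φs : Fin k → Formula L n) :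
      Formula L n
  | sup {n : ℕ} (φ : Formula L (n + 1)) : Formula L n
  | inf {n : ℕ} (φ : Formula L (n + 1)) : Formula L n

/-- `L`-sentences: formulas without free variables. -/
abbrev Sentence (L : MetricSignature.{u, v}) : Type (max u v) := Formula L 0

/-- Interpretations of the symbols of `L` on a metric space of diameter at most `1`, as yet
without any requirement of uniform continuity. -/
class Interpretation (L : MetricSignature.{u, v}) (M : Type w) [MetricSpace M] where
  dist_le_one : ∀ x y : M, dist x y ≤ 1
  funMap : ∀ {n : ℕ}, L.lang.Functions n → (Fin n → M) → M
  predMap : ∀ {n : ℕ}, L.lang.Relations n → (Fin n → M) → unitInterval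

/-- `d(a,b) < Δ(ε) → d(g a, g b) ≤ ε` for all tuples `a`, `b`, for this one `ε`
(tuples carry the maximum metric). -/
def ModulusAt {M X : Type*} [MetricSpace M] [MetricSpace X] {n : ℕ} (Δ : Modulus)
    (g : (Fin n → M) → X) (ε : Set.Ioc (0 : ℝ) 1) : Prop :=
  ∀ a b : Fin n → M, dist a b < (Δ ε : ℝ) → dist (g a) (g b) ≤ (ε : ℝ)

/-- `M` is an `L`-structure: a nonempty complete metric space of diameter at most `1` on which
the interpretation of each symbol respects its modulus of uniform continuity. -/
structure IsStructure (L : MetricSignature.{u, v}) (M : Type w) [MetricSpace M]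
    [Interpretation L M] : Prop where
  nonempty : Nonempty M
  complete : CompleteSpace M
  fun_modulus : ∀ {n : ℕ} (F : L.lang.Functions n) (ε : Set.Ioc (0 : ℝ) 1),
    ModulusAt (L.funModulus F) (Interpretation.funMap (M := M) F) ε
  pred_modulus : ∀ {n : ℕ} (P : L.lang.Relations n) (ε : Set.Ioc (0 : ℝ) 1),
    ModulusAt (L.predModulus P) (Interpretation.predMap (M := M) P) ε

/-- `M` is an almost `L`-structure: as an `L`-structure, except that the clause on the modulus of
continuity of each symbol is required for sufficiently small `ε` only. -/
structure IsAlmostStructure (L : MetricSignature.{u, v}) (M : Type w) [MetricSpace M]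
    [Interpretation L M] : Prop where
  nonempty : Nonempty M
  complete : CompleteSpace M
  fun_modulus : ∀ {n : ℕ} (F : L.lang.Functions n), ∃ ε₀ : Set.Ioc (0 : ℝ) 1, ∀ ε ≤ ε₀,
    ModulusAt (L.funModulus F) (Interpretation.funMap (M := M) F) ε
  pred_modulus : ∀ {n : ℕ} (P : L.lang.Relations n), ∃ ε₀ : Set.Ioc (0 : ℝ) 1, ∀ ε ≤ ε₀,
    ModulusAt (L.predModulus P) (Interpretation.predMap (M := M) P) ε

section Semantics

variable {L : MetricSignature.{u, v}} {M : Type w} [MetricSpace M] [Interpretation L M]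

/-- The value of a term under an assignment. -/
def termValue {n : ℕ} (a : Fin n → M) : L.lang.Term (Fin n) → M
  | .var i => a i
  | .func F ts => Interpretation.funMap F fun i => termValue a (ts i)

/-- The supremum of a `[0,1]`-valued function, as an element of `[0,1]`. -/
def supValue {ι : Type*} (g : ι → unitInterval) : unitInterval :=
  ⟨⨆ i, (g i : ℝ), Real.iSup_nonneg fun i => (g i).2.1,
    Real.iSup_le (fun i => (g i).2.2) zero_le_one⟩

/-- The infimum of a `[0,1]`-valued function on a nonempty type, as an element of `[0,1]`. -/
def infValue {ι : Type*} (g : ι → unitInterval) : unitInterval :=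
  ⟨⨅ i, (g i : ℝ), Real.iInf_nonneg fun i => (g i).2.1, by
    rcases isEmpty_or_nonempty ι with h | h
    · simp
    · exact ciInf_le_of_le ⟨0, by rintro _ ⟨i, rfl⟩; exact (g i).2.1⟩ h.some (g h.some).2.2⟩

/-- The value `φ^M(a) ∈ [0,1]` of a formula at a tuple `a` from `M`. -/
def value : {n : ℕ} → Formula L n → (Fin n → M) → unitInterval
  | _, .dist t₁ t₂, a =>
      ⟨dist (termValue a t₁) (termValue a t₂), dist_nonneg, Interpretation.dist_le_one L _ _⟩
  | _, .pred P ts, a => Interpretation.predMap P fun i => termValue a (ts i)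
  | _, .conn c φs, a => c fun i => value (φs i) a
  | _, .sup φ, a => supValue fun x : M => value φ (Fin.snoc (α := fun _ => M) a x)
  | _, .inf φ, a => infValue fun x : M => value φ (Fin.snoc (α := fun _ => M) a x)

end Semantics

/-- The value `σ^M` of a sentence in `M`. -/
def sentenceValue {L : MetricSignature.{u, v}} (σ : Sentence L) (M : Type w) [MetricSpace M]
    [Interpretation L M] : unitInterval :=
  value σ (Fin.elim0 : Fin 0 → M)

/-- `M` is strongly pseudofinite: every sentence with `σ^M = 0` has `σ^A = 0` for some finite
`L`-structure `A`. (Being finite, `A` may be taken in `Type`.) -/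
def StronglyPseudofinite (L : MetricSignature.{u, v}) (M : Type w) [MetricSpace M]
    [Interpretation L M] : Prop :=
  ∀ σ : Sentence L, sentenceValue σ M = 0 →
    ∃ (A : Type) (_ : MetricSpace A) (_ : Interpretation L A),
      Finite A ∧ IsStructure L A ∧ sentenceValue σ A = 0

/-- `M` is almost strongly pseudofinite: every sentence with `σ^M = 0` has `σ^A = 0` for some
finite almost `L`-structure `A`. (Being finite, `A` may be taken in `Type`.) -/
def AlmostStronglyPseudofinite (L : MetricSignature.{u, v}) (M : Type w) [MetricSpace M]
    [Interpretation L M] : Prop :=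
  ∀ σ : Sentence L, sentenceValue σ M = 0 →
    ∃ (A : Type) (_ : MetricSpace A) (_ : Interpretation L A),
      Finite A ∧ IsAlmostStructure L A ∧ sentenceValue σ A = 0

/-- `M` is `ω`-saturated: for every finite tuple `a` of parameters from `M` and every set `Γ` of
formulas in finitely many variables `x` besides the parameters, if every finite subset of the set
of conditions `{φ(a,x) = 0 : φ ∈ Γ}` is satisfied by some tuple of `M`, then the whole set is. -/
def OmegaSaturated (L : MetricSignature.{u, v}) (M : Type w) [MetricSpace M]
    [Interpretation L M] : Prop :=
  ∀ (k n : ℕ) (a : Fin k → M) (Γ : Set (Formula L (k + n))),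
    (∀ Γ₀ : Set (Formula L (k + n)), Γ₀ ⊆ Γ → Γ₀.Finite →
      ∃ x : Fin n → M, ∀ φ ∈ Γ₀, value φ (Fin.append a x) = 0) →
    ∃ x : Fin n → M, ∀ φ ∈ Γ, value φ (Fin.append a x) = 0

/-- `f : M → M` is formula-definable: for some formula `φ` and some finite tuple `a` of
parameters from `M`, `d(f(x),y) = φ^M(a,x,y)` for all `x`, `y`. -/
def FormulaDefinable (L : MetricSignature.{u, v}) {M : Type w} [MetricSpace M]
    [Interpretation L M] (f : M → M) : Prop :=
  ∃ (k : ℕ) (φ : Formula L (k + 2)) (a : Fin k → M),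
    ∀ x y : M, dist (f x) y = (value φ (Fin.append a ![x, y]) : ℝ)

end ContLogic

end

noncomputable section

namespace ContLogic

/-! Suppose f is surjective and identifies b and c, with r = d(b,c) > 0. One parameter-free sentence
records this: for some parameters, `φ` is zero-surjective, satisfies d(y,z) ≤ φ(x,y) + φ(x,z), and
two points at distance at least r share a zero. It has value 0 in M
(`sentenceValue_noninjectiveSurjection`), so it has value 0 in some finite almost structure A. On A
infima are attained, so there are exact witnesses. The zero set of `φ` is then the graph of a
partial function from A onto A. A section of it is an injective self-map of a finite set, hence
bijective, so the partial function is its inverse and cannot identify two points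
(`sentenceValue_noninjectiveSurjection_ne_zero`). The argument in A needs only that A is finite and
nonempty, so both forms of pseudofiniteness are treated together. -/

theorem supValue_eq_zero_iff {ι : Type*} (g : ι → unitInterval) :
    supValue g = 0 ↔ ∀ i, g i = 0 := by
  constructor
  · intro h i
    have hle : (g i : ℝ) ≤ ⨆ j, (g j : ℝ) :=
      le_ciSup (f := fun j => (g j : ℝ)) ⟨1, by rintro _ ⟨j, rfl⟩; exact (g j).2.2⟩ i
    have h0 : (⨆ j, (g j : ℝ)) = 0 := congrArg Subtype.val h
    exact Subtype.ext (le_antisymm (hle.trans h0.le) (g i).2.1)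
  · intro h
    apply Subtype.ext
    simp [supValue, h]

theorem infValue_eq_zero_of_exists {ι : Type*} {g : ι → unitInterval} (h : ∃ i, g i = 0) :
    infValue g = 0 := by
  obtain ⟨i, hi⟩ := h
  have hle : (⨅ j, (g j : ℝ)) ≤ g i :=
    ciInf_le (f := fun j => (g j : ℝ)) ⟨0, by rintro _ ⟨j, rfl⟩; exact (g j).2.1⟩ i
  rw [hi] at hle
  exact Subtype.ext (le_antisymm hle (Real.iInf_nonneg fun j => (g j).2.1))

/-- A finite nonempty family attains its infimum. This turns the approximate existence expressed by
`inf` into true existence. -/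
theorem infValue_eq_zero_iff {ι : Type*} [Finite ι] [Nonempty ι] (g : ι → unitInterval) :
    infValue g = 0 ↔ ∃ i, g i = 0 := by
  refine ⟨fun h => ?_, infValue_eq_zero_of_exists⟩
  obtain ⟨i, hi⟩ := exists_eq_ciInf_of_finite (f := fun j => (g j : ℝ))
  exact ⟨i, Subtype.ext (hi.trans (congrArg Subtype.val h))⟩

/-! ### Renaming of variables, connectives and closure under infima -/

/-- The extension of a map of variables under a quantifier. -/
def liftVar {n m : ℕ} (ρ : Fin n → Fin m) : Fin (n + 1) → Fin (m + 1) :=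
  Fin.snoc (α := fun _ => Fin (m + 1)) (fun i => (ρ i).castSucc) (Fin.last m)

/-- Carries the quantifier cases of `value_rename`. -/
theorem snoc_comp_liftVar {M : Type*} {n m : ℕ} (ρ : Fin n → Fin m) (a : Fin m → M) (x : M) :
    Fin.snoc (α := fun _ => M) a x ∘ liftVar ρ = Fin.snoc (α := fun _ => M) (a ∘ ρ) x := by
  funext i
  refine Fin.lastCases ?_ (fun i => ?_) i <;> simp [liftVar]

namespace Formula

variable {L : MetricSignature.{u, v}}

/-- Renaming of the free variables of a formula. -/
def rename : {n m : ℕ} → (Fin n → Fin m) → Formula L n → Formula L m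
  | _, _, ρ, .dist t₁ t₂ => .dist (t₁.relabel ρ) (t₂.relabel ρ)
  | _, _, ρ, .pred P ts => .pred P fun i => (ts i).relabel ρ
  | _, _, ρ, .conn c φs => .conn c fun i => rename ρ (φs i)
  | _, _, ρ, .sup φ => .sup (rename (liftVar ρ) φ)
  | _, _, ρ, .inf φ => .inf (rename (liftVar ρ) φ)

/-- The formula `d(xᵢ, xⱼ)`. -/
def distVar {n : ℕ} (i j : Fin n) : Formula L n := .dist (.var i) (.var j)

/-- The constant formula with value `r`. -/
def const {n : ℕ} (r : unitInterval) : Formula L n :=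
  .conn (k := 0) (ContinuousMap.const _ r) Fin.elim0

/-- The maximum of two formulas. -/
def max {n : ℕ} (φ ψ : Formula L n) : Formula L n :=
  .conn (k := 2) ⟨fun v => v 0 ⊔ v 1, by fun_prop⟩ ![φ, ψ]

/-- The truncated difference of two formulas. -/
def tsub {n : ℕ} (φ ψ : Formula L n) : Formula L n :=
  .conn (k := 2) ⟨fun v => Set.projIcc 0 1 zero_le_one ((v 0 : ℝ) - v 1),
    continuous_projIcc.comp (by fun_prop)⟩ ![φ, ψ]

/-- The infimum of a formula over all its free variables. -/
def infAll : {n : ℕ} → Formula L n → Sentence L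
  | 0, φ => φ
  | _ + 1, φ => infAll (.inf φ)

end Formula

section Semantics

variable {L : MetricSignature.{u, v}} {M : Type w} [MetricSpace M] [Interpretation L M]

theorem termValue_relabel {n m : ℕ} (ρ : Fin n → Fin m) (t : L.lang.Term (Fin n))
    (a : Fin m → M) : termValue a (t.relabel ρ) = termValue (a ∘ ρ) t := by
  induction t with
  | var i => rfl
  | func F ts ih => simp only [FirstOrder.Language.Term.relabel, termValue, ih]

theorem value_rename {n m : ℕ} (ρ : Fin n → Fin m) (φ : Formula L n) (a : Fin m → M) :
    value (φ.rename ρ) a = value φ (a ∘ ρ) := by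
  induction φ generalizing m with
  | dist t₁ t₂ => simp only [Formula.rename, value, termValue_relabel]
  | pred P ts => simp only [Formula.rename, value, termValue_relabel]
  | conn c φs ih => simp only [Formula.rename, value, ih]
  | sup φ ih => simp only [Formula.rename, value, ih, snoc_comp_liftVar]
  | inf φ ih => simp only [Formula.rename, value, ih, snoc_comp_liftVar]

theorem coe_value_distVar {n : ℕ} (i j : Fin n) (a : Fin n → M) :
    (value (Formula.distVar (L := L) i j) a : ℝ) = dist (a i) (a j) := rfl

theorem value_const {n : ℕ} (r : unitInterval) (a : Fin n → M) :
    value (Formula.const (L := L) r) a = r := rfl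

theorem value_max_eq_zero_iff {n : ℕ} (φ ψ : Formula L n) (a : Fin n → M) :
    value (φ.max ψ) a = 0 ↔ value φ a = 0 ∧ value ψ a = 0 := by
  change value φ a ⊔ value ψ a = (⊥ : unitInterval) ↔ _
  exact sup_eq_bot_iff

theorem coe_value_tsub {n : ℕ} (φ ψ : Formula L n) (a : Fin n → M) :
    (value (φ.tsub ψ) a : ℝ) = Max.max 0 ((value φ a : ℝ) - value ψ a) := by
  change ((Set.projIcc (0 : ℝ) 1 zero_le_one ((value φ a : ℝ) - value ψ a) : unitInterval) : ℝ) = _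
  rw [Set.coe_projIcc, min_eq_right]
  linarith [(value φ a).2.2, (value ψ a).2.1]

theorem value_tsub_eq_zero_iff {n : ℕ} (φ ψ : Formula L n) (a : Fin n → M) :
    value (φ.tsub ψ) a = 0 ↔ (value φ a : ℝ) ≤ value ψ a := by
  rw [Subtype.ext_iff, coe_value_tsub, Set.Icc.coe_zero, max_eq_left_iff, sub_nonpos]

theorem sentenceValue_infAll_of_exists {n : ℕ} {φ : Formula L n}
    (h : ∃ a : Fin n → M, value φ a = 0) : sentenceValue φ.infAll M = 0 := by
  induction n with
  | zero =>
    obtain ⟨a, ha⟩ := h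
    rwa [Subsingleton.elim a Fin.elim0] at ha
  | succ n ih =>
    obtain ⟨a, ha⟩ := h
    refine ih ⟨Fin.init a, infValue_eq_zero_of_exists ⟨a (Fin.last n), ?_⟩⟩
    rwa [Fin.snoc_init_self]

theorem exists_of_sentenceValue_infAll [Finite M] [Nonempty M] {n : ℕ} {φ : Formula L n}
    (h : sentenceValue φ.infAll M = 0) : ∃ a : Fin n → M, value φ a = 0 := by
  induction n with
  | zero => exact ⟨_, h⟩
  | succ n ih =>
    obtain ⟨a, ha⟩ := ih h
    obtain ⟨x, hx⟩ := (infValue_eq_zero_iff _).1 ha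
    exact ⟨_, hx⟩

end Semantics

/-! ### The sentence expressing a non-injective surjection -/

section Surjective

variable {L : MetricSignature.{u, v}} {M : Type w} [MetricSpace M] [Interpretation L M]

/-- The value of a formula at the tuple `(a, x, y)`. -/
def valueAt {k : ℕ} (φ : Formula L (k + 2)) (a : Fin k → M) (x y : M) : unitInterval :=
  value φ (Fin.snoc (α := fun _ => M) (Fin.snoc (α := fun _ => M) a x) y)

/-- Reconciles `Fin.append`, used in `FormulaDefinable`, with the iterated `Fin.snoc` by which
quantifiers are evaluated. -/
theorem append_pair {X : Type*} {k : ℕ} (a : Fin k → X) (x y : X) :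
    Fin.append a ![x, y] =
      Fin.snoc (α := fun _ => X) (Fin.snoc (α := fun _ => X) a x) y := by
  funext i
  refine Fin.addCases (fun i => ?_) (fun i => ?_) i
  · rw [Fin.append_left]
    change _ = Fin.snoc (α := fun _ => X) _ y i.castSucc.castSucc
    simp
  · rw [Fin.append_right]
    fin_cases i
    · change _ = Fin.snoc (α := fun _ => X) _ y (Fin.last k).castSucc
      simp
    · change _ = Fin.snoc (α := fun _ => X) _ y (Fin.last (k + 1))
      simp

namespace Formula

/-- Substitution of the variables `i`, `j` for the last two variables of a formula, the first `k`
variables staying in place. -/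
def atVars {k : ℕ} (l : ℕ) (φ : Formula L (k + 2)) (i j : Fin (k + l)) : Formula L (k + l) :=
  φ.rename (Fin.snoc (α := fun _ => Fin (k + l))
    (Fin.snoc (α := fun _ => Fin (k + l)) (Fin.castAdd l) i) j)

/-- `sup_y inf_x φ(a, x, y)` -/
def surjectivity {k : ℕ} (φ : Formula L (k + 2)) : Formula L k :=
  .sup (.inf (φ.atVars 2 (Fin.natAdd k 1) (Fin.natAdd k 0)))

/-- `sup_x sup_y sup_z (d(y, z) ∸ φ(a, x, y) ∸ φ(a, x, z))` -/
def functionality {k : ℕ} (φ : Formula L (k + 2)) : Formula L k :=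
  .sup (.sup (.sup
    (((distVar (Fin.natAdd k 1) (Fin.natAdd k 2)).tsub
      (φ.atVars 3 (Fin.natAdd k 0) (Fin.natAdd k 1))).tsub
      (φ.atVars 3 (Fin.natAdd k 0) (Fin.natAdd k 2)))))

/-- `inf_x inf_y inf_z max(r ∸ d(x, y), φ(a, x, z), φ(a, y, z))` -/
def collision {k : ℕ} (r : unitInterval) (φ : Formula L (k + 2)) : Formula L k :=
  .inf (.inf (.inf
    (((const r).tsub (distVar (Fin.natAdd k 0) (Fin.natAdd k 1))).max
      ((φ.atVars 3 (Fin.natAdd k 0) (Fin.natAdd k 2)).max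
        (φ.atVars 3 (Fin.natAdd k 1) (Fin.natAdd k 2))))))

end Formula

theorem value_atVars {k l : ℕ} (φ : Formula L (k + 2)) (i j : Fin (k + l))
    (b : Fin (k + l) → M) :
    value (φ.atVars l i j) b = valueAt φ (fun s => b (Fin.castAdd l s)) (b i) (b j) := by
  rw [Formula.atVars, value_rename, valueAt]
  congr 1
  rw [Fin.comp_snoc, Fin.comp_snoc]
  rfl

section Snoc

variable {X : Type*} {k : ℕ} (a : Fin k → X) (x y z : X)

/-- The tuple `(a, x, y)`. -/
abbrev snocTwo : Fin (k + 2) → X :=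
  Fin.snoc (α := fun _ => X) (Fin.snoc (α := fun _ => X) a x) y

/-- The tuple `(a, x, y, z)`. -/
abbrev snocThree : Fin (k + 3) → X :=
  Fin.snoc (α := fun _ => X) (snocTwo a x y) z

theorem snocTwo_castAdd (s : Fin k) : snocTwo a x y (Fin.castAdd 2 s) = a s := by
  change Fin.snoc (α := fun _ => X) _ y s.castSucc.castSucc = _
  simp

theorem snocTwo_zero : snocTwo a x y (Fin.natAdd k 0) = x := by
  change Fin.snoc (α := fun _ => X) _ y (Fin.last k).castSucc = _
  simp

theorem snocTwo_one : snocTwo a x y (Fin.natAdd k 1) = y := by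
  change Fin.snoc (α := fun _ => X) _ y (Fin.last (k + 1)) = _
  simp

theorem snocThree_castAdd (s : Fin k) : snocThree a x y z (Fin.castAdd 3 s) = a s := by
  change Fin.snoc (α := fun _ => X) _ z (Fin.castAdd 2 s).castSucc = _
  rw [Fin.snoc_castSucc, snocTwo_castAdd]

theorem snocThree_zero : snocThree a x y z (Fin.natAdd k 0) = x := by
  change Fin.snoc (α := fun _ => X) _ z (Fin.natAdd k (0 : Fin 2)).castSucc = _
  rw [Fin.snoc_castSucc, snocTwo_zero]

theorem snocThree_one : snocThree a x y z (Fin.natAdd k 1) = y := by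
  change Fin.snoc (α := fun _ => X) _ z (Fin.natAdd k (1 : Fin 2)).castSucc = _
  rw [Fin.snoc_castSucc, snocTwo_one]

theorem snocThree_two : snocThree a x y z (Fin.natAdd k 2) = z := by
  change Fin.snoc (α := fun _ => X) _ z (Fin.last (k + 2)) = _
  simp

end Snoc

theorem value_surjectivity {k : ℕ} (φ : Formula L (k + 2)) (a : Fin k → M) :
    value φ.surjectivity a = supValue fun y : M => infValue fun x : M => valueAt φ a x y := by
  -- The outer quantifier binds y, so y precedes x in the tuple; this is why `surjectivity` swaps
  -- the two indices.
  change (supValue fun y : M => infValue fun x : M => value _ (snocTwo a y x)) = _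
  simp only [value_atVars, snocTwo_castAdd, snocTwo_zero, snocTwo_one]

theorem value_functionality_eq_zero_iff {k : ℕ} (φ : Formula L (k + 2)) (a : Fin k → M) :
    value φ.functionality a = 0 ↔
      ∀ x y z : M, dist y z ≤ (valueAt φ a x y : ℝ) + valueAt φ a x z := by
  change (supValue fun x : M => supValue fun y : M => supValue fun z : M =>
    value _ (snocThree a x y z)) = 0 ↔ _
  simp only [supValue_eq_zero_iff, value_tsub_eq_zero_iff, coe_value_tsub, coe_value_distVar,
    value_atVars, snocThree_castAdd, snocThree_zero, snocThree_one, snocThree_two]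
  refine forall₃_congr fun x y z => ?_
  -- The truncation at 0 costs nothing, because the right-hand side is nonnegative.
  rw [max_le_iff, sub_le_iff_le_add', and_iff_right (valueAt φ a x z).2.1]

theorem value_collision {k : ℕ} (r : unitInterval) (φ : Formula L (k + 2)) (a : Fin k → M) :
    value (φ.collision r) a =
      infValue fun x : M => infValue fun y : M => infValue fun z : M =>
        value (((Formula.const r).tsub (.distVar (Fin.natAdd k 0) (Fin.natAdd k 1))).max
          ((φ.atVars 3 (Fin.natAdd k 0) (Fin.natAdd k 2)).max
            (φ.atVars 3 (Fin.natAdd k 1) (Fin.natAdd k 2)))) (snocThree a x y z) := rfl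

theorem value_collision_body_eq_zero_iff {k : ℕ} (r : unitInterval) (φ : Formula L (k + 2))
    (a : Fin k → M) (x y z : M) :
    value (((Formula.const r).tsub (.distVar (Fin.natAdd k 0) (Fin.natAdd k 1))).max
      ((φ.atVars 3 (Fin.natAdd k 0) (Fin.natAdd k 2)).max
        (φ.atVars 3 (Fin.natAdd k 1) (Fin.natAdd k 2)))) (snocThree a x y z) = 0 ↔
      (r : ℝ) ≤ dist x y ∧ valueAt φ a x z = 0 ∧ valueAt φ a y z = 0 := by
  simp only [value_max_eq_zero_iff, value_tsub_eq_zero_iff, value_const, coe_value_distVar,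
    value_atVars, snocThree_castAdd, snocThree_zero, snocThree_one, snocThree_two]

/-- The sentence saying that, for some parameters, `φ` is the graph of a surjective partial
function which identifies two points at distance at least `r`. -/
def noninjectiveSurjection {k : ℕ} (r : unitInterval) (φ : Formula L (k + 2)) : Sentence L :=
  (φ.surjectivity.max (φ.functionality.max (φ.collision r))).infAll

theorem sentenceValue_noninjectiveSurjection {k : ℕ} {φ : Formula L (k + 2)} {a : Fin k → M}
    {f : M → M} (hφ : ∀ x y : M, dist (f x) y = (valueAt φ a x y : ℝ))
    (hf : Function.Surjective f) {b c : M} (hbc : f b = f c) {r : unitInterval}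
    (hr : (r : ℝ) ≤ dist b c) : sentenceValue (noninjectiveSurjection r φ) M = 0 := by
  have h0 : ∀ x, valueAt φ a x (f x) = 0 := fun x =>
    Subtype.ext ((hφ x (f x)).symm.trans (dist_self _))
  refine sentenceValue_infAll_of_exists ⟨a, ?_⟩
  rw [value_max_eq_zero_iff, value_max_eq_zero_iff]
  refine ⟨?_, ?_, ?_⟩
  · rw [value_surjectivity, supValue_eq_zero_iff]
    intro y
    obtain ⟨x, rfl⟩ := hf y
    exact infValue_eq_zero_of_exists ⟨x, h0 x⟩
  · rw [value_functionality_eq_zero_iff]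
    intro x y z
    rw [← hφ, ← hφ]
    exact dist_triangle_left y z (f x)
  · rw [value_collision]
    refine infValue_eq_zero_of_exists ⟨b, infValue_eq_zero_of_exists
      ⟨c, infValue_eq_zero_of_exists ⟨f b, ?_⟩⟩⟩
    rw [value_collision_body_eq_zero_iff]
    exact ⟨hr, h0 b, hbc ▸ h0 c⟩

theorem sentenceValue_noninjectiveSurjection_ne_zero [Finite M] [Nonempty M] {k : ℕ}
    (φ : Formula L (k + 2)) {r : unitInterval} (hr : 0 < (r : ℝ)) :
    sentenceValue (noninjectiveSurjection r φ) M ≠ 0 := by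
  intro h
  obtain ⟨a, ha⟩ := exists_of_sentenceValue_infAll h
  rw [value_max_eq_zero_iff, value_max_eq_zero_iff, value_surjectivity, supValue_eq_zero_iff,
    value_functionality_eq_zero_iff, value_collision] at ha
  obtain ⟨hsurj, hfun, hcol⟩ := ha
  simp only [infValue_eq_zero_iff, value_collision_body_eq_zero_iff] at hsurj hcol
  -- On the zero set of `φ` the bound on d(y,z) is 0, so x determines y.
  have huniq : ∀ {x y z : M}, valueAt φ a x y = 0 → valueAt φ a x z = 0 → y = z := by
    intro x y z hy hz
    have := hfun x y z
    rw [hy, hz] at this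
    exact dist_le_zero.1 (by simpa using this)
  choose g hg using hsurj
  have hg_inj : Function.Injective g := fun y z hyz => huniq (hg y) (hyz ▸ hg z)
  have hg_surj : Function.Surjective g := Finite.injective_iff_surjective.1 hg_inj
  obtain ⟨b, c, z, hbc, hb, hc⟩ := hcol
  -- Both colliding points lie in the image of the section, so their common value z is the preimage
  -- of each; hence they coincide.
  obtain ⟨y, rfl⟩ := hg_surj b
  obtain ⟨y', rfl⟩ := hg_surj c
  rw [huniq (hg y) hb, huniq (hg y') hc, dist_self] at hbc
  exact hr.not_ge hbc

end Surjective

/-! ### Pseudofiniteness and the conclusion -/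

theorem IsStructure.isAlmostStructure {L : MetricSignature.{u, v}} {M : Type w} [MetricSpace M]
    [Interpretation L M] (h : IsStructure L M) : IsAlmostStructure L M where
  nonempty := h.nonempty
  complete := h.complete
  fun_modulus F := ⟨⟨1, by simp⟩, fun ε _ => h.fun_modulus F ε⟩
  pred_modulus P := ⟨⟨1, by simp⟩, fun ε _ => h.pred_modulus P ε⟩

theorem StronglyPseudofinite.almostStronglyPseudofinite {L : MetricSignature.{u, v}} {M : Type w}
    [MetricSpace M] [Interpretation L M] (h : StronglyPseudofinite L M) :
    AlmostStronglyPseudofinite L M := fun σ hσ =>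
  let ⟨A, i, j, hfin, hA, hσA⟩ := h σ hσ
  ⟨A, i, j, hfin, hA.isAlmostStructure, hσA⟩

theorem AlmostStronglyPseudofinite.injective_of_surjective {L : MetricSignature.{u, v}}
    {M : Type w} [MetricSpace M] [Interpretation L M] (h : AlmostStronglyPseudofinite L M)
    {f : M → M} (hdef : FormulaDefinable L f) (hf : Function.Surjective f) :
    Function.Injective f := by
  intro b c hbc
  by_contra hne
  obtain ⟨k, φ, a, hφ⟩ := hdef
  -- The gap enters the sentence as a constant connective, so it survives the passage to A, where b
  -- and c have no meaning.
  let r : unitInterval := ⟨dist b c, dist_nonneg, Interpretation.dist_le_one L b c⟩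
  simp only [append_pair] at hφ
  obtain ⟨A, _, _, _, hA, hσ⟩ :=
    h _ (sentenceValue_noninjectiveSurjection (r := r) hφ hf hbc le_rfl)
  have := hA.nonempty
  exact sentenceValue_noninjectiveSurjection_ne_zero φ (r := r) (dist_pos.2 hne) hσ

end ContLogic

end

theorem mainTheorem5 (L : ContLogic.MetricSignature.{u, v}) (M : Type w)
    [MetricSpace M] [ContLogic.Interpretation L M] (hM : ContLogic.IsStructure L M)
    (hsat : ContLogic.OmegaSaturated L M) :
    (ContLogic.StronglyPseudofinite L M →
      ∀ f : M → M, ContLogic.FormulaDefinable L f → Function.Surjective f →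
        Function.Injective f) ∧
    (ContLogic.AlmostStronglyPseudofinite L M →
      ∀ f : M → M, ContLogic.FormulaDefinable L f → Function.Surjective f →
        Function.Injective f) :=
  ⟨fun h _ hdef hf => h.almostStronglyPseudofinite.injective_of_surjective hdef hf,
    fun h _ hdef hf => h.injective_of_surjective hdef hf⟩
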